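/- Let $N\ge 0$ and $p_1,\dots,p_N\in[0,1]$. Let $b^N=(b_1,\dots,b_N)\in\{0,1\}^N$ be a random sequence with independent bits, $\Pr(b_i=1)=p_i$. For $b^N,\hat b^N\in\{0,1\}^N$ put $d(b^N,\hat b^N)=\sum_{i=1}^N\delta(b_i,\hat b_i)$, where $$\delta(0,0)=1,\quad \delta(0,1)=3,\quad \delta(1,0)=1,\quad \delta(1,1)=0 .$$ The overall rate-distortion function $R(D)$ is the infimum of the mutual information $I(b^N;\hat b^N)$, in bits, over all test channels (conditional laws of $\hat b^N\in\{0,1\}^N$ given $b^N$) with $\mathbb E\,d(b^N,\hat b^N)\le D$. Let $H(p)=-p\log_2 p-(1-p)\log_2(1-p)$ be the binary entropy (with $H(0)=H(1)=0$), $[x]^+=\max\{x,0\}$, and for $\lambda\in(0,1)$ put $$R_i(\lambda)=H(p_i)-H\Bigl(\tfrac{1+\lambda}{1+\lambda+\lambda^2}\Bigr)+\Bigl(p_i-\tfrac{1+\lambda}{1+\lambda+\lambda^2}\Bigr)H\Bigl(\tfrac{\lambda}{1+\lambda}\Bigr),$$ $$D_i(\lambda)=\begin{cases}\dfrac{1+2\lambda+3\lambda^2}{1+\lambda+\lambda^2}-p_i\,\dfrac{1+2\lambda}{1+\lambda}&\text{if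 }R_i(\lambda)>0,\\[2mm] \min\{1,3(1-p_i)\}&\text{otherwise.}\end{cases}$$ (a) For every $D$ with $\sum_{i}(1-p_i)<D<\sum_{i}\min\{1,3(1-p_i)\}$ there is $\lambda\in(0,1)$ with $\sum_{i=1}^N D_i(\lambda)=D$. (b) Whenever $\lambda\in(0,1)$ and $\sum_{i=1}^N D_i(\lambda)=D$, $$R(D)=\sum_{i=1}^N\bigl[R_i(\lambda)\bigr]^+ .$$ Moreover $R(D)$ is achieved by a test channel that acts independently on the bits, for which $\hat b_1,\dots,\hat b_N$ are independent, $\mathbb E\,d(b^N,\hat b^N)=D$, $I(b^N;\hat b^N)=R(D)$, and for every $i$: $\mathbb E\,\delta(b_i,\hat b_i)=D_i(\lambda)$, $I(b_i;\hat b_i)=[R_i(\lambda)]^+$, and the test-channel input distribution $q_{i,k}=\Pr(\hat b_i=k)$ is $$q_{i,0}=\frac{(1+\lambda)-p_i(1+\lambda+\lambda^2)}{1-\lambda^2},\qquad q_{i,1}=\frac{p_i(1+\lambda+\lambda^2)-\lambda(1+\lambda)}{1-\lambda^2}\qquad\text{if }R_i(\lambda)>0,$$ while, if $R_i(\lambda)\le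 0$, $(q_{i,0},q_{i,1})=(0,1)$ when $3(1-p_i)\le1$ and $(1,0)$ otherwise. -/

import Mathlib

open scoped BigOperators

namespace BitASD

noncomputable section

/-! Rate-distortion theory on finite alphabets: a source law is a mass function `P`, a test channel
is a matrix of transition probabilities, and rates are measured in bits. -/

/-- `W x y` is the conditional probability of the reproduction letter `y` given the source
letter `x`. -/
def IsTestChannel {α β : Type*} [Fintype β] (W : α → β → ℝ) : Prop :=
  (∀ x y, 0 ≤ W x y) ∧ ∀ x, ∑ y, W x y = 1

/-- The law of the reproduction letter under the source law `P` and the test channel `W`. -/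
def reproductionLaw {α β : Type*} [Fintype α] (P : α → ℝ) (W : α → β → ℝ) (y : β) : ℝ :=
  ∑ x, P x * W x y

/-- The mutual information, in bits, between the source letter and the reproduction letter. -/
def mutualInformation {α β : Type*} [Fintype α] [Fintype β] (P : α → ℝ) (W : α → β → ℝ) : ℝ :=
  ∑ x, ∑ y, P x * W x y * Real.logb 2 (W x y / reproductionLaw P W y)

/-- The expectation of the distortion `d` under the source law `P` and the test channel `W`. -/
def expectedDistortion {α β : Type*} [Fintype α] [Fintype β]
    (P : α → ℝ) (d : α → β → ℝ) (W : α → β → ℝ) : ℝ :=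
  ∑ x, ∑ y, P x * W x y * d x y

/-- The rate-distortion function of the source law `P` for the distortion `d`: the infimum of the
mutual information over all test channels of expected distortion at most `D`. -/
def rateDistortion {α β : Type*} [Fintype α] [Fintype β]
    (P : α → ℝ) (d : α → β → ℝ) (D : ℝ) : ℝ :=
  sInf {R : ℝ | ∃ W : α → β → ℝ,
    IsTestChannel W ∧ expectedDistortion P d W ≤ D ∧ mutualInformation P W = R}

/-! Bit-level patterns: elements of `Fin N → Fin 2`. -/

/-- The bit-level distortion: `δ(0,0) = 1`, `δ(0,1) = 3`, `δ(1,0) = 1`, `δ(1,1) = 0`. -/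
def bitDistortion : Fin 2 → Fin 2 → ℝ := ![![1, 3], ![1, 0]]

/-- The distortion between an error pattern and an erasure pattern. -/
def patternDistortion {N : ℕ} (b c : Fin N → Fin 2) : ℝ := ∑ i, bitDistortion (b i) (c i)

/-- The law on one bit with `Pr(1) = p`. -/
def bitLaw (p : ℝ) : Fin 2 → ℝ := ![1 - p, p]

/-- The law on patterns under which the bits are independent, the `i`-th with law `m i`. -/
def productLaw {N : ℕ} (m : Fin N → Fin 2 → ℝ) (b : Fin N → Fin 2) : ℝ := ∏ i, m i (b i)

/-- The law of an error pattern with independent bits, `Pr(b i = 1) = p i`. -/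
def sourceLaw {N : ℕ} (p : Fin N → ℝ) : (Fin N → Fin 2) → ℝ := productLaw fun i => bitLaw (p i)

/-- The channel on patterns that uses the channel `w i` independently on the `i`-th bit. -/
def productChannel {N : ℕ} (w : Fin N → Fin 2 → Fin 2 → ℝ) (b c : Fin N → Fin 2) : ℝ :=
  ∏ i, w i (b i) (c i)

/-! The closed forms. -/

/-- The binary entropy function, in bits. -/
def binaryEntropy (p : ℝ) : ℝ := Real.binEntropy p / Real.log 2

/-- The closed form `R_i(lam)`, for `p = p_i`. -/
def rateTerm (p lam : ℝ) : ℝ :=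
  binaryEntropy p - binaryEntropy ((1 + lam) / (1 + lam + lam ^ 2))
    + (p - (1 + lam) / (1 + lam + lam ^ 2)) * binaryEntropy (lam / (1 + lam))

/-- The distortion component `D_i`, for `p = p_i`. -/
def distortionTerm (p lam : ℝ) : ℝ :=
  if 0 < rateTerm p lam then
    (1 + 2 * lam + 3 * lam ^ 2) / (1 + lam + lam ^ 2) - p * ((1 + 2 * lam) / (1 + lam))
  else min 1 (3 * (1 - p))

/-- The test-channel input distribution `(q_{i,0}, q_{i,1})`, for `p = p_i`. Where the rate term is
not positive, it is the point mass at the constant reproduction letter of least expected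
distortion: that is `1` for the letter `0` and `3 (1 - p)` for the letter `1`. -/
def inputLaw (p lam : ℝ) : Fin 2 → ℝ :=
  if 0 < rateTerm p lam then
    ![((1 + lam) - p * (1 + lam + lam ^ 2)) / (1 - lam ^ 2),
      (p * (1 + lam + lam ^ 2) - lam * (1 + lam)) / (1 - lam ^ 2)]
  else if 3 * (1 - p) ≤ 1 then ![0, 1] else ![1, 0]

end

end BitASD

-- The proof is Lagrangian duality at slope `Real.logb 2 lam`. For a law `q` on the reproduction
-- letters, tilt it to the channel proportional to `q y * lam ^ d x y`. If the Kuhn-Tucker sums of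
-- `q` are at most `1`, then `1 - 1/t ≤ log t` bounds the mutual information of every channel below
-- by an affine function of its distortion (`IsKuhnTuckerLaw.le_mutualInformation`). If moreover the
-- sums equal `1` on the support of `q`, the tilted channel has output law `q` and meets the bound,
-- so it is optimal at its own distortion.
--
-- Since `lam` to a sum is a product, tilt masses and Kuhn-Tucker sums factor over the bits: a
-- product of bitwise optimal laws at a common `lam` is optimal for patterns
-- (`IsKuhnTuckerLaw.productLaw`). It remains to check the conditions on one bit
-- (`isKuhnTuckerLaw_inputLaw`). They split at two thresholds in `p`, which are the zeros of the
-- strictly concave function `rateTerm · lam` (`rateTerm_pos_iff`).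
--
-- For the existence of `lam`, each distortion component extends continuously to `[0, 1]`, and the
-- intermediate value theorem applies to the sum.

namespace BitASD

noncomputable section

-- Kuhn-Tucker conditions and Lagrangian duality on finite alphabets

section General

variable {α β : Type*} [Fintype β]

/-- The normalizing factor of the exponentially tilted law `y ↦ q y * lam ^ d x y`. -/
def tiltMass (d : α → β → ℝ) (q : β → ℝ) (lam : ℝ) (x : α) : ℝ :=
  ∑ y, q y * lam ^ d x y

/-- The test channel whose transition laws are the exponential tilts of `q`. -/
def tiltedChannel (d : α → β → ℝ) (q : β → ℝ) (lam : ℝ) (x : α) (y : β) : ℝ :=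
  q y * (lam ^ d x y / tiltMass d q lam x)

variable {d : α → β → ℝ} {q : β → ℝ} {lam : ℝ}

theorem tiltMass_pos (hlam : 0 < lam) (hq : ∀ y, 0 ≤ q y) (hq1 : ∑ y, q y = 1) (x : α) :
    0 < tiltMass d q lam x := by
  obtain ⟨y, -, hy⟩ : ∃ y ∈ Finset.univ, q y ≠ 0 :=
    Finset.exists_ne_zero_of_sum_ne_zero (by rw [hq1]; exact one_ne_zero)
  exact Finset.sum_pos' (fun z _ => mul_nonneg (hq z) (Real.rpow_nonneg hlam.le _))
    ⟨y, Finset.mem_univ y, mul_pos ((hq y).lt_of_ne' hy) (Real.rpow_pos_of_pos hlam _)⟩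

theorem isTestChannel_tiltedChannel (hlam : 0 < lam) (hq : ∀ y, 0 ≤ q y)
    (hq1 : ∑ y, q y = 1) : IsTestChannel (tiltedChannel d q lam) := by
  refine ⟨fun x y => mul_nonneg (hq y) (div_nonneg (Real.rpow_nonneg hlam.le _)
    (tiltMass_pos hlam hq hq1 x).le), fun x => ?_⟩
  have h := (tiltMass_pos (d := d) hlam hq hq1 x).ne'
  simp only [tiltedChannel, ← mul_div_assoc, ← Finset.sum_div]
  exact div_self h

variable [Fintype α] {P : α → ℝ}

/-- The Kuhn-Tucker sum of the reproduction letter `y`. -/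
def kuhnTuckerSum (P : α → ℝ) (d : α → β → ℝ) (q : β → ℝ) (lam : ℝ) (y : β) : ℝ :=
  ∑ x, P x * (lam ^ d x y / tiltMass d q lam x)

/-- `q` is a law on the reproduction letters that satisfies the Kuhn-Tucker conditions of the
rate-distortion problem at the parameter `lam`. -/
structure IsKuhnTuckerLaw (P : α → ℝ) (d : α → β → ℝ) (q : β → ℝ) (lam : ℝ) : Prop where
  nonneg : ∀ y, 0 ≤ q y
  sum_eq_one : ∑ y, q y = 1
  kuhnTuckerSum_le_one : ∀ y, kuhnTuckerSum P d q lam y ≤ 1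
  mul_kuhnTuckerSum : ∀ y, q y * kuhnTuckerSum P d q lam y = q y

/-- The output mass at `y` is `q y` times the Kuhn-Tucker sum of `y`, so this is complementary
slackness. -/
theorem IsKuhnTuckerLaw.reproductionLaw_tiltedChannel (h : IsKuhnTuckerLaw P d q lam) :
    reproductionLaw P (tiltedChannel d q lam) = q := by
  funext y
  rw [← h.mul_kuhnTuckerSum y, kuhnTuckerSum, Finset.mul_sum]
  exact Finset.sum_congr rfl fun x _ => by rw [tiltedChannel]; ring

/-- The expectation of `logb 2 (lam ^ d x y / tiltMass x)` under any test channel. -/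
theorem sum_mul_logb_tilt (hlam : 0 < lam) (hq : ∀ y, 0 ≤ q y) (hq1 : ∑ y, q y = 1)
    {W : α → β → ℝ} (hW : IsTestChannel W) :
    ∑ x, ∑ y, P x * W x y * Real.logb 2 (lam ^ d x y / tiltMass d q lam x)
      = Real.logb 2 lam * expectedDistortion P d W
        - ∑ x, P x * Real.logb 2 (tiltMass d q lam x) := by
  rw [expectedDistortion, Finset.mul_sum, ← Finset.sum_sub_distrib]
  refine Finset.sum_congr rfl fun x _ => ?_
  have hx : P x * Real.logb 2 (tiltMass d q lam x)
      = ∑ y, P x * W x y * Real.logb 2 (tiltMass d q lam x) := by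
    rw [← Finset.sum_mul, ← Finset.mul_sum, hW.2 x, mul_one]
  rw [hx, Finset.mul_sum, ← Finset.sum_sub_distrib]
  refine Finset.sum_congr rfl fun y _ => ?_
  rw [Real.logb_div (Real.rpow_pos_of_pos hlam _).ne' (tiltMass_pos hlam hq hq1 x).ne',
    Real.logb_rpow_eq_mul_logb_of_pos hlam]
  ring

/-- As the output law is `q`, the ratio inside the logarithm is the tilt itself wherever `q y ≠ 0`;
the Lagrangian bound is attained. -/
theorem IsKuhnTuckerLaw.mutualInformation_tiltedChannel (hlam : 0 < lam)
    (h : IsKuhnTuckerLaw P d q lam) :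
    mutualInformation P (tiltedChannel d q lam)
      = Real.logb 2 lam * expectedDistortion P d (tiltedChannel d q lam)
        - ∑ x, P x * Real.logb 2 (tiltMass d q lam x) := by
  rw [← sum_mul_logb_tilt hlam h.nonneg h.sum_eq_one
    (isTestChannel_tiltedChannel hlam h.nonneg h.sum_eq_one), mutualInformation,
    h.reproductionLaw_tiltedChannel]
  refine Finset.sum_congr rfl fun x _ => Finset.sum_congr rfl fun y _ => ?_
  by_cases hy : q y = 0
  · simp [tiltedChannel, hy]
  · rw [tiltedChannel, mul_div_cancel_left₀ _ hy]

/-- The Lagrangian lower bound on the mutual information of an arbitrary test channel. -/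
theorem IsKuhnTuckerLaw.le_mutualInformation (hP : ∀ x, 0 ≤ P x) (hP1 : ∑ x, P x = 1)
    (hlam : 0 < lam) (h : IsKuhnTuckerLaw P d q lam) {W : α → β → ℝ} (hW : IsTestChannel W) :
    Real.logb 2 lam * expectedDistortion P d W - ∑ x, P x * Real.logb 2 (tiltMass d q lam x)
      ≤ mutualInformation P W := by
  rw [← sum_mul_logb_tilt hlam h.nonneg h.sum_eq_one hW]
  have hlog2 : 0 < Real.log 2 := Real.log_pos one_lt_two
  set r := reproductionLaw P W with hr
  have hr0 : ∀ y, 0 ≤ r y := fun y => Finset.sum_nonneg fun x _ => mul_nonneg (hP x) (hW.1 x y)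
  have hPW : ∑ x, ∑ y, P x * W x y = 1 := by
    simp only [← Finset.mul_sum, hW.2, mul_one, hP1]
  have hr1 : ∑ y, r y = 1 := by
    rw [← hPW, Finset.sum_comm]; rfl
  -- Termwise `1 - 1/t ≤ log t`, with `t` the ratio of `W x y / r y` to the tilt; the factor
  -- `Real.log 2` turns bits into nats.
  have hterm : ∀ x y, (P x * W x y - r y * (P x * (lam ^ d x y / tiltMass d q lam x)))
      ≤ (P x * W x y * Real.logb 2 (W x y / r y)
        - P x * W x y * Real.logb 2 (lam ^ d x y / tiltMass d q lam x)) * Real.log 2 := by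
    intro x y
    have ht : 0 < lam ^ d x y / tiltMass d q lam x :=
      div_pos (Real.rpow_pos_of_pos hlam _) (tiltMass_pos hlam h.nonneg h.sum_eq_one x)
    rcases (mul_nonneg (hP x) (hW.1 x y)).eq_or_lt with h0 | h0
    · rw [← h0]
      have := mul_nonneg (hr0 y) (mul_nonneg (hP x) ht.le)
      simpa using this
    · have hWpos : 0 < W x y := (hW.1 x y).lt_of_ne' (right_ne_zero_of_mul h0.ne')
      have hrpos : 0 < r y := h0.trans_le
        (Finset.single_le_sum (f := fun x => P x * W x y)
          (fun z _ => mul_nonneg (hP z) (hW.1 z y)) (Finset.mem_univ x))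
      generalize lam ^ d x y / tiltMass d q lam x = t at ht ⊢
      have key := Real.one_sub_inv_le_log_of_pos (div_pos (div_pos hWpos hrpos) ht)
      rw [Real.log_div (div_pos hWpos hrpos).ne' ht.ne'] at key
      have hmul := mul_le_mul_of_nonneg_left key h0.le
      calc P x * W x y - r y * (P x * t)
          = P x * W x y * (1 - (W x y / r y / t)⁻¹) := by field_simp
        _ ≤ _ := hmul
        _ = _ := by simp only [Real.logb]; field_simp
  -- The Kuhn-Tucker inequalities, averaged over the output law of `W`, make the total of the left
  -- sides of `hterm` nonnegative.
  have hKT : ∑ x, ∑ y, r y * (P x * (lam ^ d x y / tiltMass d q lam x)) ≤ 1 := by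
    rw [Finset.sum_comm, ← hr1]
    refine Finset.sum_le_sum fun y _ => ?_
    rw [← Finset.mul_sum]
    exact mul_le_of_le_one_right (hr0 y) (h.kuhnTuckerSum_le_one y)
  have hsum := Finset.sum_le_sum fun x (_ : x ∈ Finset.univ) =>
    Finset.sum_le_sum fun y (_ : y ∈ Finset.univ) => hterm x y
  simp only [← Finset.sum_mul, Finset.sum_sub_distrib, hPW] at hsum
  have := nonneg_of_mul_nonneg_left ((sub_nonneg.2 hKT).trans hsum) hlog2
  rw [mutualInformation]
  linarith

/-- A channel tilted from a law that satisfies the Kuhn-Tucker conditions achieves the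
rate-distortion function at its own expected distortion. -/
theorem IsKuhnTuckerLaw.rateDistortion_eq (hP : ∀ x, 0 ≤ P x) (hP1 : ∑ x, P x = 1)
    (hlam : 0 < lam) (hlam1 : lam < 1) (h : IsKuhnTuckerLaw P d q lam) :
    rateDistortion P d (expectedDistortion P d (tiltedChannel d q lam))
      = mutualInformation P (tiltedChannel d q lam) := by
  refine IsLeast.csInf_eq ⟨⟨_, isTestChannel_tiltedChannel hlam h.nonneg h.sum_eq_one,
    le_rfl, rfl⟩, ?_⟩
  rintro _ ⟨W, hW, hd, rfl⟩
  refine le_trans ?_ (h.le_mutualInformation hP hP1 hlam hW)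
  rw [h.mutualInformation_tiltedChannel hlam]
  -- The slope is negative, so a distortion below the allowed one only raises the lower bound.
  have := mul_le_mul_of_nonpos_left hd (Real.logb_neg one_lt_two hlam hlam1).le
  linarith

end General

-- Factorization over independent bits

section Product

variable {N : ℕ}

theorem sum_prod_apply (f : Fin N → Fin 2 → ℝ) :
    ∑ b : Fin N → Fin 2, ∏ i, f i (b i) = ∏ i, ∑ x, f i x := by
  rw [Finset.prod_univ_sum, Fintype.piFinset_univ]

theorem productLaw_nonneg {m : Fin N → Fin 2 → ℝ} (hm : ∀ i x, 0 ≤ m i x)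
    (b : Fin N → Fin 2) : 0 ≤ productLaw m b :=
  Finset.prod_nonneg fun i _ => hm i (b i)

theorem sum_productLaw {m : Fin N → Fin 2 → ℝ} (hm : ∀ i, ∑ x, m i x = 1) :
    ∑ b, productLaw m b = 1 := by
  simp only [productLaw, sum_prod_apply, hm, Finset.prod_const_one]

theorem sum_productLaw_mul_sum {m : Fin N → Fin 2 → ℝ} (hm : ∀ i, ∑ x, m i x = 1)
    (f : Fin N → Fin 2 → ℝ) :
    ∑ b, productLaw m b * ∑ i, f i (b i) = ∑ i, ∑ x, m i x * f i x := by
  simp only [Finset.mul_sum]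
  rw [Finset.sum_comm]
  refine Finset.sum_congr rfl fun i _ => ?_
  -- Written as a product over all coordinates, the sum over patterns factors, and every factor
  -- except the `i`-th is a total mass `1`.
  have h : ∀ b : Fin N → Fin 2, productLaw m b * f i (b i)
      = ∏ j, m j (b j) * if j = i then f j (b j) else 1 := fun b => by
    rw [Finset.prod_mul_distrib, Finset.prod_ite_eq' Finset.univ i fun j => f j (b j),
      if_pos (Finset.mem_univ i), productLaw]
  simp only [h]
  rw [sum_prod_apply fun j x => m j x * if j = i then f j x else 1,
    Finset.prod_eq_single i (fun j _ hj => by simp [hj, hm]) (by simp)]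
  simp

variable {q : Fin N → Fin 2 → ℝ} {lam : ℝ}

theorem rpow_patternDistortion (hlam : 0 < lam) (b c : Fin N → Fin 2) :
    lam ^ patternDistortion b c = ∏ i, lam ^ bitDistortion (b i) (c i) :=
  Real.rpow_sum_of_pos hlam _ _

theorem tiltMass_patternDistortion (hlam : 0 < lam) (b : Fin N → Fin 2) :
    tiltMass patternDistortion (productLaw q) lam b
      = ∏ i, tiltMass bitDistortion (q i) lam (b i) := by
  simp only [tiltMass, rpow_patternDistortion hlam, productLaw, ← Finset.prod_mul_distrib]
  exact sum_prod_apply fun i y => q i y * lam ^ bitDistortion (b i) y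

theorem tiltedChannel_patternDistortion (hlam : 0 < lam) :
    tiltedChannel patternDistortion (productLaw q) lam
      = productChannel fun i => tiltedChannel bitDistortion (q i) lam := by
  funext b c
  simp only [tiltedChannel, productChannel, tiltMass_patternDistortion hlam,
    rpow_patternDistortion hlam, productLaw, Finset.prod_mul_distrib, Finset.prod_div_distrib]

variable {P : Fin N → Fin 2 → ℝ}

theorem kuhnTuckerSum_patternDistortion (hlam : 0 < lam) (c : Fin N → Fin 2) :
    kuhnTuckerSum (productLaw P) patternDistortion (productLaw q) lam c
      = ∏ i, kuhnTuckerSum (P i) bitDistortion (q i) lam (c i) := by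
  simp only [kuhnTuckerSum, tiltMass_patternDistortion hlam, rpow_patternDistortion hlam,
    productLaw, ← Finset.prod_div_distrib, ← Finset.prod_mul_distrib]
  exact sum_prod_apply fun i x =>
    P i x * (lam ^ bitDistortion x (c i) / tiltMass bitDistortion (q i) lam x)

theorem IsKuhnTuckerLaw.productLaw (hP : ∀ i x, 0 ≤ P i x) (hlam : 0 < lam)
    (h : ∀ i, IsKuhnTuckerLaw (P i) bitDistortion (q i) lam) :
    IsKuhnTuckerLaw (productLaw P) patternDistortion (productLaw q) lam where
  nonneg := productLaw_nonneg fun i => (h i).nonneg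
  sum_eq_one := sum_productLaw fun i => (h i).sum_eq_one
  kuhnTuckerSum_le_one c := by
    rw [kuhnTuckerSum_patternDistortion hlam]
    refine Finset.prod_le_one (fun i _ => ?_) fun i _ => (h i).kuhnTuckerSum_le_one _
    exact Finset.sum_nonneg fun x _ => mul_nonneg (hP i x) (div_nonneg
      (Real.rpow_nonneg hlam.le _) (tiltMass_pos hlam (h i).nonneg (h i).sum_eq_one x).le)
  mul_kuhnTuckerSum c := by
    rw [kuhnTuckerSum_patternDistortion hlam, BitASD.productLaw, ← Finset.prod_mul_distrib]
    exact Finset.prod_congr rfl fun i _ => (h i).mul_kuhnTuckerSum _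

theorem expectedDistortion_productChannel (hP : ∀ i, ∑ x, P i x = 1)
    {w : Fin N → Fin 2 → Fin 2 → ℝ} (hw : ∀ i, IsTestChannel (w i)) :
    expectedDistortion (productLaw P) patternDistortion (productChannel w)
      = ∑ i, expectedDistortion (P i) bitDistortion (w i) := by
  have h : ∀ b : Fin N → Fin 2, ∑ c, productLaw P b * productChannel w b c * patternDistortion b c
      = productLaw P b * ∑ i, ∑ y, w i (b i) y * bitDistortion (b i) y := fun b => by
    rw [← sum_productLaw_mul_sum (m := fun i => w i (b i)) (fun i => (hw i).2 (b i))
      fun i => bitDistortion (b i), Finset.mul_sum]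
    exact Finset.sum_congr rfl fun c _ => mul_assoc _ _ _
  rw [expectedDistortion]
  simp only [h]
  rw [sum_productLaw_mul_sum hP fun i x => ∑ y, w i x y * bitDistortion x y]
  simp only [expectedDistortion, Finset.mul_sum, mul_assoc]

/-- Both sides are given by the closed formula for tilted channels, whose distortion and log-mass
parts are each additive over the bits. -/
theorem mutualInformation_productChannel_tiltedChannel (hP : ∀ i x, 0 ≤ P i x)
    (hP1 : ∀ i, ∑ x, P i x = 1) (hlam : 0 < lam)
    (h : ∀ i, IsKuhnTuckerLaw (P i) bitDistortion (q i) lam) :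
    mutualInformation (productLaw P) (productChannel fun i => tiltedChannel bitDistortion (q i) lam)
      = ∑ i, mutualInformation (P i) (tiltedChannel bitDistortion (q i) lam) := by
  have hw i := isTestChannel_tiltedChannel (d := bitDistortion) hlam (h i).nonneg (h i).sum_eq_one
  simp only [fun i => (h i).mutualInformation_tiltedChannel hlam]
  rw [Finset.sum_sub_distrib, ← Finset.mul_sum, ← expectedDistortion_productChannel hP1 hw,
    ← tiltedChannel_patternDistortion hlam,
    (IsKuhnTuckerLaw.productLaw hP hlam h).mutualInformation_tiltedChannel hlam,
    ← sum_productLaw_mul_sum hP1 fun i x => Real.logb 2 (tiltMass bitDistortion (q i) lam x)]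
  congr 1
  refine Finset.sum_congr rfl fun b _ => ?_
  rw [tiltMass_patternDistortion hlam, Real.logb_prod]
  exact fun i _ => (tiltMass_pos hlam (h i).nonneg (h i).sum_eq_one _).ne'

end Product

-- The single-bit problem

section Bit

variable {p lam : ℝ}

theorem bitLaw_nonneg (hp0 : 0 ≤ p) (hp1 : p ≤ 1) (x : Fin 2) : 0 ≤ bitLaw p x := by
  fin_cases x <;> simp [bitLaw, hp0, hp1]

theorem sum_bitLaw (p : ℝ) : ∑ x, bitLaw p x = 1 := by
  simp [bitLaw]

/-- The source probability at which the letter `1` enters the optimal reproduction law. -/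
def lowerThreshold (lam : ℝ) : ℝ := lam * (1 + lam) / (1 + lam + lam ^ 2)

/-- The source probability at which the letter `0` leaves the optimal reproduction law. -/
def upperThreshold (lam : ℝ) : ℝ := (1 + lam) / (1 + lam + lam ^ 2)

/-- Expanding the two entropies that depend only on `lam` leaves logarithms of `lam`, `1 + lam` and
`1 + lam + lam ^ 2`, the form in which the logarithms of the tilt masses also appear. -/
theorem log_two_mul_rateTerm (hlam : 0 < lam) :
    Real.log 2 * rateTerm p lam = Real.binEntropy p - Real.log (1 + lam + lam ^ 2)
      + (lam + 2 * lam ^ 2) / (1 + lam + lam ^ 2) * Real.log lam + p * Real.log (1 + lam)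
      - p * (lam / (1 + lam)) * Real.log lam := by
  have hT : 0 < 1 + lam + lam ^ 2 := by positivity
  have h1 : 0 < 1 + lam := by positivity
  have hlog2 : Real.log 2 ≠ 0 := (Real.log_pos one_lt_two).ne'
  have hb : 1 - (1 + lam) / (1 + lam + lam ^ 2) = lam ^ 2 / (1 + lam + lam ^ 2) := by
    field_simp; ring
  have hc : 1 - lam / (1 + lam) = 1 / (1 + lam) := by field_simp; ring
  have e1 : Real.binEntropy ((1 + lam) / (1 + lam + lam ^ 2))
      = Real.log (1 + lam + lam ^ 2) - (1 + lam) / (1 + lam + lam ^ 2) * Real.log (1 + lam)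
        - lam ^ 2 / (1 + lam + lam ^ 2) * (2 * Real.log lam) := by
    rw [Real.binEntropy_eq_negMulLog_add_negMulLog_one_sub, hb, Real.negMulLog, Real.negMulLog,
      Real.log_div h1.ne' hT.ne', Real.log_div (by positivity) hT.ne', Real.log_pow]
    field_simp
    push_cast
    ring
  have e2 : Real.binEntropy (lam / (1 + lam))
      = Real.log (1 + lam) - lam / (1 + lam) * Real.log lam := by
    rw [Real.binEntropy_eq_negMulLog_add_negMulLog_one_sub, hc, Real.negMulLog, Real.negMulLog,
      Real.log_div hlam.ne' h1.ne', Real.log_div one_ne_zero h1.ne', Real.log_one]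
    field_simp
    ring
  rw [rateTerm, binaryEntropy, binaryEntropy, binaryEntropy, e1, e2]
  field_simp
  ring

theorem rateTerm_upperThreshold : rateTerm (upperThreshold lam) lam = 0 := by
  simp [rateTerm, upperThreshold]

theorem rateTerm_lowerThreshold (hlam : 0 < lam) : rateTerm (lowerThreshold lam) lam = 0 := by
  have hT : 0 < 1 + lam + lam ^ 2 := by positivity
  have h1 : 0 < 1 + lam := by positivity
  have ha : 1 - lam * (1 + lam) / (1 + lam + lam ^ 2) = 1 / (1 + lam + lam ^ 2) := by
    field_simp; ring
  refine (mul_eq_zero.1 ?_).resolve_left (Real.log_pos one_lt_two).ne'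
  rw [log_two_mul_rateTerm hlam, Real.binEntropy_eq_negMulLog_add_negMulLog_one_sub,
    lowerThreshold, ha, Real.negMulLog, Real.negMulLog, Real.log_div (by positivity) hT.ne',
    Real.log_mul hlam.ne' h1.ne', Real.log_div one_ne_zero hT.ne', Real.log_one]
  field_simp
  ring

/-- In `p` the rate term is the binary entropy plus an affine function. -/
theorem strictConcaveOn_rateTerm (lam : ℝ) :
    StrictConcaveOn ℝ (Set.Icc 0 1) fun p => rateTerm p lam := by
  have hlog2 : 0 < Real.log 2 := Real.log_pos one_lt_two
  refine ⟨convex_Icc 0 1, fun x hx y hy hxy s t hs ht hst => ?_⟩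
  have h := Real.strictConcave_binEntropy.2 hx hy hxy hs ht hst
  have h' := div_lt_div_of_pos_right h hlog2
  obtain rfl : t = 1 - s := by linarith
  simp only [smul_eq_mul, rateTerm, binaryEntropy, add_div, mul_div_assoc] at h' ⊢
  linear_combination h'

theorem lowerThreshold_pos (hlam : 0 < lam) : 0 < lowerThreshold lam := by
  unfold lowerThreshold; positivity

theorem upperThreshold_lt_one (hlam : 0 < lam) : upperThreshold lam < 1 := by
  rw [upperThreshold, div_lt_one (by positivity)]
  nlinarith [sq_pos_of_pos hlam]

/-- The value `2 / 3` is where `3 * (1 - p) = 1`, so the two thresholds lie on either side of the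
point where the best constant letter changes. -/
theorem lowerThreshold_lt_two_thirds (hlam : 0 < lam) (hlam1 : lam < 1) :
    lowerThreshold lam < 2 / 3 := by
  rw [lowerThreshold, div_lt_div_iff₀ (by positivity) (by norm_num)]
  nlinarith

theorem two_thirds_lt_upperThreshold (hlam : 0 < lam) (hlam1 : lam < 1) :
    2 / 3 < upperThreshold lam := by
  rw [upperThreshold, div_lt_div_iff₀ (by norm_num) (by positivity)]
  nlinarith

/-- A strictly concave function with two zeros is positive exactly between them. -/
theorem rateTerm_pos_iff (hp0 : 0 ≤ p) (hp1 : p ≤ 1) (hlam : 0 < lam) (hlam1 : lam < 1) :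
    0 < rateTerm p lam ↔ lowerThreshold lam < p ∧ p < upperThreshold lam := by
  have hab := (lowerThreshold_lt_two_thirds hlam hlam1).trans
    (two_thirds_lt_upperThreshold hlam hlam1)
  have ha := lowerThreshold_pos hlam
  have hb := upperThreshold_lt_one hlam
  have hRa := rateTerm_lowerThreshold hlam
  have hRb := rateTerm_upperThreshold (lam := lam)
  have hseg : ∀ {x y z : ℝ}, x ∈ Set.Icc (0 : ℝ) 1 → y ∈ Set.Icc (0 : ℝ) 1 → x < z → z < y →
      min (rateTerm x lam) (rateTerm y lam) < rateTerm z lam := by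
    intro x y z hx hy hxz hzy
    refine (strictConcaveOn_rateTerm lam).lt_on_openSegment hx hy (hxz.trans hzy).ne ?_
    rw [openSegment_eq_Ioo (hxz.trans hzy)]
    exact ⟨hxz, hzy⟩
  have ha' : lowerThreshold lam ∈ Set.Icc (0 : ℝ) 1 := ⟨ha.le, (hab.trans hb).le⟩
  have hb' : upperThreshold lam ∈ Set.Icc (0 : ℝ) 1 := ⟨(ha.trans hab).le, hb.le⟩
  refine ⟨fun hR => ⟨?_, ?_⟩, fun h => ?_⟩
  · by_contra! hle
    rcases hle.eq_or_lt with rfl | hlt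
    · exact hR.ne' hRa
    -- A positive value left of the lower threshold would force a positive value at that threshold,
    -- which lies between `p` and the other zero.
    · have := hseg ⟨hp0, hp1⟩ hb' hlt hab
      rw [hRa, hRb, min_eq_right hR.le] at this
      exact this.false
  · by_contra! hle
    rcases hle.eq_or_lt with rfl | hlt
    · exact hR.ne' hRb
    · have := hseg ha' ⟨hp0, hp1⟩ hab hlt
      rw [hRa, hRb, min_eq_left hR.le] at this
      exact this.false
  · have := hseg ha' hb' h.1 h.2
    rwa [hRa, hRb, min_self] at this

/-- The three regimes of the closed forms. -/
theorem closedForm_cases (hp0 : 0 ≤ p) (hp1 : p ≤ 1) (hlam : 0 < lam) (hlam1 : lam < 1) :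
    (0 < rateTerm p lam ∧ lowerThreshold lam < p ∧ p < upperThreshold lam) ∨
    (rateTerm p lam ≤ 0 ∧ p ≤ lowerThreshold lam ∧ inputLaw p lam = ![1, 0] ∧
      distortionTerm p lam = 1) ∨
    (rateTerm p lam ≤ 0 ∧ upperThreshold lam ≤ p ∧ inputLaw p lam = ![0, 1] ∧
      distortionTerm p lam = 3 * (1 - p)) := by
  have ha := lowerThreshold_lt_two_thirds hlam hlam1
  have hb := two_thirds_lt_upperThreshold hlam hlam1
  have hiff := rateTerm_pos_iff hp0 hp1 hlam hlam1
  by_cases hR : 0 < rateTerm p lam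
  · exact Or.inl ⟨hR, hiff.1 hR⟩
  · right
    rw [inputLaw, distortionTerm, if_neg hR, if_neg hR]
    rcases le_or_gt p (lowerThreshold lam) with h | h
    · left
      refine ⟨not_lt.1 hR, h, if_neg (by linarith), min_eq_left (by linarith)⟩
    · right
      have hle : upperThreshold lam ≤ p := not_lt.1 fun h' => hR (hiff.2 ⟨h, h'⟩)
      refine ⟨not_lt.1 hR, hle, if_pos (by linarith), min_eq_right (by linarith)⟩

theorem tiltMass_bitDistortion (q : Fin 2 → ℝ) (lam : ℝ) :
    tiltMass bitDistortion q lam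
      = ![q 0 * lam + q 1 * lam ^ 3, q 0 * lam + q 1] := by
  have h3 : lam ^ (3 : ℝ) = lam ^ 3 := by norm_cast
  funext x
  fin_cases x <;> simp [tiltMass, bitDistortion, h3]

theorem kuhnTuckerSum_bitDistortion (q : Fin 2 → ℝ) (p lam : ℝ) :
    kuhnTuckerSum (bitLaw p) bitDistortion q lam
      = ![(1 - p) * (lam / (q 0 * lam + q 1 * lam ^ 3)) + p * (lam / (q 0 * lam + q 1)),
        (1 - p) * (lam ^ 3 / (q 0 * lam + q 1 * lam ^ 3)) + p * (1 / (q 0 * lam + q 1))] := by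
  have h3 : lam ^ (3 : ℝ) = lam ^ 3 := by norm_cast
  funext y
  fin_cases y <;> simp [kuhnTuckerSum, tiltMass_bitDistortion] <;> simp [bitDistortion, bitLaw, h3]

theorem expectedDistortion_tiltedChannel_bit (q : Fin 2 → ℝ) (p lam : ℝ) :
    expectedDistortion (bitLaw p) bitDistortion (tiltedChannel bitDistortion q lam)
      = (1 - p) * (q 0 * (lam / (q 0 * lam + q 1 * lam ^ 3)))
        + (1 - p) * (q 1 * (lam ^ 3 / (q 0 * lam + q 1 * lam ^ 3))) * 3
        + p * (q 0 * (lam / (q 0 * lam + q 1))) := by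
  have h3 : lam ^ (3 : ℝ) = lam ^ 3 := by norm_cast
  simp only [expectedDistortion, tiltedChannel, tiltMass_bitDistortion]
  simp [bitDistortion, bitLaw, h3]

/-- The tilt masses of the closed-form input law where the rate term is positive. -/
theorem inputLaw_tilt (hlam : 0 < lam) (hlam1 : lam < 1) (hR : 0 < rateTerm p lam) :
    inputLaw p lam 0 * lam + inputLaw p lam 1 * lam ^ 3
      = (1 - p) * (lam * (1 + lam + lam ^ 2)) ∧
    inputLaw p lam 0 * lam + inputLaw p lam 1 = p * ((1 + lam + lam ^ 2) / (1 + lam)) := by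
  have h1 : 1 + lam ≠ 0 := by positivity
  have h2 : 1 - lam ≠ 0 := (sub_pos.2 hlam1).ne'
  have h3 : 1 - lam ^ 2 = (1 + lam) * (1 - lam) := by ring
  rw [inputLaw, if_pos hR]
  simp only [Matrix.cons_val_zero, Matrix.cons_val_one, h3]
  constructor <;> field_simp <;> ring

/-- Between the thresholds both Kuhn-Tucker sums are `1`. Outside, `q` is a point mass, and the
inequality for the unused letter is the threshold inequality multiplied by `1 - lam`. -/
theorem isKuhnTuckerLaw_inputLaw (hp0 : 0 ≤ p) (hp1 : p ≤ 1) (hlam : 0 < lam) (hlam1 : lam < 1) :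
    IsKuhnTuckerLaw (bitLaw p) bitDistortion (inputLaw p lam) lam := by
  have hT : 0 < 1 + lam + lam ^ 2 := by positivity
  have h1 : 0 < 1 + lam := by positivity
  have h2 : 0 < 1 - lam := sub_pos.2 hlam1
  rcases closedForm_cases hp0 hp1 hlam hlam1 with ⟨hR, ha, hb⟩ | ⟨-, ha, hq, -⟩ | ⟨-, hb, hq, -⟩
  · have hp0' : 0 < p := (lowerThreshold_pos hlam).trans ha
    have hp1' : 0 < 1 - p := sub_pos.2 (hb.trans (upperThreshold_lt_one hlam))
    have hKT : ∀ y, kuhnTuckerSum (bitLaw p) bitDistortion (inputLaw p lam) lam y = 1 := by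
      intro y
      rw [kuhnTuckerSum_bitDistortion, (inputLaw_tilt hlam hlam1 hR).1,
        (inputLaw_tilt hlam hlam1 hR).2]
      fin_cases y <;> simp <;> field_simp <;> ring
    have h3 : 0 < 1 - lam ^ 2 := by nlinarith
    rw [lowerThreshold, div_lt_iff₀ hT] at ha
    rw [upperThreshold, lt_div_iff₀ hT] at hb
    refine ⟨fun y => ?_, ?_, fun y => (hKT y).le, fun y => by rw [hKT, mul_one]⟩
    · rw [inputLaw, if_pos hR]
      fin_cases y
      · exact div_nonneg (sub_nonneg.2 hb.le) h3.le
      · exact div_nonneg (sub_nonneg.2 ha.le) h3.le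
    · simp only [inputLaw, if_pos hR, Fin.sum_univ_two, Matrix.cons_val_zero, Matrix.cons_val_one]
      field_simp
      ring
  · rw [hq]
    rw [lowerThreshold, le_div_iff₀ hT] at ha
    refine ⟨fun y => ?_, by simp, fun y => ?_, fun y => ?_⟩
    · fin_cases y <;> simp
    · rw [kuhnTuckerSum_bitDistortion]
      fin_cases y
      · simp [hlam.ne']
      · have : (1 - p) * (lam ^ 3 / lam) + p * (1 / lam) ≤ 1 := by
          rw [← mul_le_mul_iff_left₀ hlam]
          field_simp
          nlinarith [mul_le_mul_of_nonneg_left ha h2.le]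
        simpa using this
    · rw [kuhnTuckerSum_bitDistortion]
      fin_cases y <;> simp [hlam.ne']
  · rw [hq]
    rw [upperThreshold, div_le_iff₀ hT] at hb
    refine ⟨fun y => ?_, by simp, fun y => ?_, fun y => ?_⟩
    · fin_cases y <;> simp
    · rw [kuhnTuckerSum_bitDistortion]
      fin_cases y
      · have : (1 - p) * (lam / lam ^ 3) + p * lam ≤ 1 := by
          rw [← mul_le_mul_iff_left₀ (pow_pos hlam 2)]
          field_simp
          nlinarith [mul_le_mul_of_nonneg_left hb h2.le]
        simpa using this
      · simp [hlam.ne']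
    · rw [kuhnTuckerSum_bitDistortion]
      fin_cases y <;> simp [hlam.ne']

theorem expectedDistortion_inputLaw (hp0 : 0 ≤ p) (hp1 : p ≤ 1) (hlam : 0 < lam)
    (hlam1 : lam < 1) :
    expectedDistortion (bitLaw p) bitDistortion
      (tiltedChannel bitDistortion (inputLaw p lam) lam) = distortionTerm p lam := by
  rw [expectedDistortion_tiltedChannel_bit]
  rcases closedForm_cases hp0 hp1 hlam hlam1 with ⟨hR, ha, hb⟩ | ⟨-, -, hq, hD⟩ | ⟨-, -, hq, hD⟩
  · have hp0' : 0 < p := (lowerThreshold_pos hlam).trans ha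
    have hp1' : 0 < 1 - p := sub_pos.2 (hb.trans (upperThreshold_lt_one hlam))
    rw [(inputLaw_tilt hlam hlam1 hR).1, (inputLaw_tilt hlam hlam1 hR).2, inputLaw,
      distortionTerm, if_pos hR, if_pos hR]
    have h1 : 0 < 1 + lam := by positivity
    have h2 : 0 < 1 - lam := sub_pos.2 hlam1
    have h3 : 1 - lam ^ 2 = (1 + lam) * (1 - lam) := by ring
    simp only [Matrix.cons_val_zero, Matrix.cons_val_one, h3]
    field_simp
    ring
  · simp [hq, hD, hlam.ne']
  · simp [hq, hD, hlam.ne', mul_comm]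

theorem mutualInformation_inputLaw (hp0 : 0 ≤ p) (hp1 : p ≤ 1) (hlam : 0 < lam)
    (hlam1 : lam < 1) :
    mutualInformation (bitLaw p) (tiltedChannel bitDistortion (inputLaw p lam) lam)
      = max (rateTerm p lam) 0 := by
  have hlog2 : Real.log 2 ≠ 0 := (Real.log_pos one_lt_two).ne'
  rw [(isKuhnTuckerLaw_inputLaw hp0 hp1 hlam hlam1).mutualInformation_tiltedChannel hlam,
    expectedDistortion_inputLaw hp0 hp1 hlam hlam1, tiltMass_bitDistortion]
  simp only [Fin.sum_univ_two, bitLaw, Matrix.cons_val_zero, Matrix.cons_val_one]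
  rcases closedForm_cases hp0 hp1 hlam hlam1 with
    ⟨hR, ha, hb⟩ | ⟨hR, -, hq, hD⟩ | ⟨hR, -, hq, hD⟩
  · have hp0' : 0 < p := (lowerThreshold_pos hlam).trans ha
    have hp1' : 0 < 1 - p := sub_pos.2 (hb.trans (upperThreshold_lt_one hlam))
    have h1 : 0 < 1 + lam := by positivity
    have hT : 0 < 1 + lam + lam ^ 2 := by positivity
    rw [max_eq_left hR.le, (inputLaw_tilt hlam hlam1 hR).1, (inputLaw_tilt hlam hlam1 hR).2,
      distortionTerm, if_pos hR]
    refine mul_left_cancel₀ hlog2 ?_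
    rw [log_two_mul_rateTerm hlam, Real.binEntropy_eq_negMulLog_add_negMulLog_one_sub,
      Real.negMulLog, Real.negMulLog]
    simp only [Real.logb]
    rw [Real.log_mul hp1'.ne' (by positivity), Real.log_mul hlam.ne' hT.ne',
      Real.log_mul hp0'.ne' (by positivity), Real.log_div hT.ne' h1.ne']
    field_simp
    ring
  · rw [max_eq_right hR, hq, hD]
    simp
    ring
  · rw [max_eq_right hR, hq, hD]
    simp [Real.logb_pow]
    ring

/-- The distortion component is continuous in the parameter, up to the ends of the interval. -/
theorem exists_continuousOn_distortionTerm (hp0 : 0 ≤ p) (hp1 : p ≤ 1) :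
    ∃ g : ℝ → ℝ, ContinuousOn g (Set.Icc 0 1) ∧ g 0 = 1 - p ∧ g 1 = min 1 (3 * (1 - p)) ∧
      ∀ lam, 0 < lam → lam < 1 → g lam = distortionTerm p lam := by
  -- Clamp `p` between the thresholds in the formula for positive rate. At the lower threshold it
  -- gives `1`; at the upper one, `b`, it gives `3 * (1 - b)`, which the last term corrects to `3 *
  -- (1 - p)`. At `t = 0` the thresholds are `0` and `1`; at `t = 1` both are `2 / 3`.
  refine ⟨fun t => (1 + 2 * t + 3 * t ^ 2) / (1 + t + t ^ 2)
      - max (lowerThreshold t) (min p (upperThreshold t)) * ((1 + 2 * t) / (1 + t))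
      - 3 * max (p - upperThreshold t) 0, ?_, ?_, ?_, fun lam hlam hlam1 => ?_⟩
  · have hT : ∀ t ∈ Set.Icc (0 : ℝ) 1, 1 + t + t ^ 2 ≠ 0 := fun t ht => by
      have := ht.1; positivity
    have h1 : ∀ t ∈ Set.Icc (0 : ℝ) 1, 1 + t ≠ 0 := fun t ht => by
      have := ht.1; positivity
    have ha : ContinuousOn lowerThreshold (Set.Icc 0 1) :=
      ContinuousOn.div (by fun_prop) (by fun_prop) hT
    have hb : ContinuousOn upperThreshold (Set.Icc 0 1) :=
      ContinuousOn.div (by fun_prop) (by fun_prop) hT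
    have hc : ContinuousOn (fun t : ℝ => (1 + 2 * t + 3 * t ^ 2) / (1 + t + t ^ 2))
        (Set.Icc 0 1) := ContinuousOn.div (by fun_prop) (by fun_prop) hT
    have hd : ContinuousOn (fun t : ℝ => (1 + 2 * t) / (1 + t)) (Set.Icc 0 1) :=
      ContinuousOn.div (by fun_prop) (by fun_prop) h1
    exact (hc.sub ((ha.sup (continuousOn_const.inf hb)).mul hd)).sub
      (continuousOn_const.mul ((continuousOn_const.sub hb).sup continuousOn_const))
  · simp [lowerThreshold, upperThreshold, hp0, hp1]
  · have ha : lowerThreshold 1 = 2 / 3 := by norm_num [lowerThreshold]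
    have hb : upperThreshold 1 = 2 / 3 := by norm_num [upperThreshold]
    simp only [ha, hb, max_eq_left (min_le_right p (2 / 3))]
    rcases le_total p (2 / 3) with h | h
    · rw [max_eq_right (by linarith), min_eq_left (by linarith)]
      norm_num
    · rw [max_eq_left (by linarith), min_eq_right (by linarith)]
      ring
  · have hT : 0 < 1 + lam + lam ^ 2 := by positivity
    have h1 : 0 < 1 + lam := by positivity
    have hab := (lowerThreshold_lt_two_thirds hlam hlam1).trans
      (two_thirds_lt_upperThreshold hlam hlam1)
    beta_reduce
    rcases closedForm_cases hp0 hp1 hlam hlam1 with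
      ⟨hR, ha, hb⟩ | ⟨-, ha, -, hD⟩ | ⟨-, hb, -, hD⟩
    · rw [distortionTerm, if_pos hR, min_eq_left hb.le, max_eq_right ha.le,
        max_eq_right (sub_nonpos.2 hb.le), mul_zero, sub_zero]
    · rw [hD, min_eq_left (ha.trans hab.le), max_eq_left ha,
        max_eq_right (sub_nonpos.2 (ha.trans hab.le)), lowerThreshold]
      field_simp
      ring
    · rw [hD, min_eq_right hb, max_eq_right hab.le, max_eq_left (sub_nonneg.2 hb),
        upperThreshold]
      field_simp
      ring

end Bit

-- Existence of the parameter, and the main theorem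

theorem exists_sum_distortionTerm_eq {N : ℕ} {p : Fin N → ℝ} (hp : ∀ i, 0 ≤ p i ∧ p i ≤ 1)
    {D : ℝ} (hD0 : ∑ i, (1 - p i) < D) (hD1 : D < ∑ i, min 1 (3 * (1 - p i))) :
    ∃ lam : ℝ, 0 < lam ∧ lam < 1 ∧ ∑ i, distortionTerm (p i) lam = D := by
  choose g hg hg0 hg1 hgD using fun i => exists_continuousOn_distortionTerm (hp i).1 (hp i).2
  have hcont : ContinuousOn (fun t => ∑ i, g i t) (Set.Icc 0 1) :=
    continuousOn_finsetSum _ fun i _ => hg i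
  obtain ⟨lam, hlam, hsum⟩ := intermediate_value_Ioo zero_le_one hcont
    (show D ∈ Set.Ioo (∑ i, g i 0) (∑ i, g i 1) by simpa only [hg0, hg1] using ⟨hD0, hD1⟩)
  refine ⟨lam, hlam.1, hlam.2, ?_⟩
  rw [← hsum]
  exact Finset.sum_congr rfl fun i _ => (hgD i lam hlam.1 hlam.2).symm

end

end BitASD

theorem mainTheorem4 (N : ℕ) (p : Fin N → ℝ) (hp : ∀ i, 0 ≤ p i ∧ p i ≤ 1) :
    -- the parameter exists for every distortion strictly between the least feasible one
    -- and the one attained at rate zero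
    (∀ D : ℝ, ∑ i, (1 - p i) < D → D < ∑ i, min 1 (3 * (1 - p i)) →
      ∃ lam : ℝ, 0 < lam ∧ lam < 1 ∧ ∑ i, BitASD.distortionTerm (p i) lam = D) ∧
    (∀ D lam : ℝ, 0 < lam → lam < 1 → ∑ i, BitASD.distortionTerm (p i) lam = D →
      -- the overall rate-distortion function
      BitASD.rateDistortion (BitASD.sourceLaw p) BitASD.patternDistortion D
        = ∑ i, max (BitASD.rateTerm (p i) lam) 0 ∧
      -- an achieving test channel with the stated input distributions and components
      ∃ w : Fin N → Fin 2 → Fin 2 → ℝ,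
        (∀ i, BitASD.IsTestChannel (w i) ∧
          BitASD.reproductionLaw (BitASD.bitLaw (p i)) (w i) = BitASD.inputLaw (p i) lam ∧
          BitASD.expectedDistortion (BitASD.bitLaw (p i)) BitASD.bitDistortion (w i)
            = BitASD.distortionTerm (p i) lam ∧
          BitASD.mutualInformation (BitASD.bitLaw (p i)) (w i)
            = max (BitASD.rateTerm (p i) lam) 0) ∧
        BitASD.IsTestChannel (BitASD.productChannel w) ∧
        BitASD.reproductionLaw (BitASD.sourceLaw p) (BitASD.productChannel w)
          = BitASD.productLaw (fun i => BitASD.inputLaw (p i) lam) ∧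
        BitASD.expectedDistortion (BitASD.sourceLaw p) BitASD.patternDistortion
          (BitASD.productChannel w) = D ∧
        BitASD.mutualInformation (BitASD.sourceLaw p) (BitASD.productChannel w)
          = BitASD.rateDistortion (BitASD.sourceLaw p) BitASD.patternDistortion D) := by
  refine ⟨fun D => BitASD.exists_sum_distortionTerm_eq hp, fun D lam hlam hlam1 hD => ?_⟩
  have hP i := BitASD.bitLaw_nonneg (hp i).1 (hp i).2
  have hP1 i := BitASD.sum_bitLaw (p i)
  have hKT i := BitASD.isKuhnTuckerLaw_inputLaw (hp i).1 (hp i).2 hlam hlam1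
  have hw i := BitASD.isTestChannel_tiltedChannel (d := BitASD.bitDistortion) hlam
    (hKT i).nonneg (hKT i).sum_eq_one
  have hKTprod := BitASD.IsKuhnTuckerLaw.productLaw hP hlam hKT
  have hE i := BitASD.expectedDistortion_inputLaw (hp i).1 (hp i).2 hlam hlam1
  have hI i := BitASD.mutualInformation_inputLaw (hp i).1 (hp i).2 hlam hlam1
  have hEprod := BitASD.expectedDistortion_productChannel hP1 hw
  have hIprod := BitASD.mutualInformation_productChannel_tiltedChannel hP hP1 hlam hKT
  have hrate := hKTprod.rateDistortion_eq (BitASD.productLaw_nonneg hP)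
    (BitASD.sum_productLaw hP1) hlam hlam1
  have hlaw := hKTprod.reproductionLaw_tiltedChannel
  have htest := BitASD.isTestChannel_tiltedChannel (d := BitASD.patternDistortion) hlam
    hKTprod.nonneg hKTprod.sum_eq_one
  simp only [hE, hD] at hEprod
  simp only [hI] at hIprod
  rw [BitASD.tiltedChannel_patternDistortion hlam] at hrate hlaw htest
  rw [hEprod] at hrate
  -- The witness is the family of bitwise tilted channels; their product is the tilted channel of
  -- the product law.
  exact ⟨hrate.trans hIprod, _, fun i => ⟨hw i, (hKT i).reproductionLaw_tiltedChannel, hE i, hI i⟩,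
    htest, hlaw, hEprod, hrate.symm⟩
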